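/- Let $\mathcal A,\mathcal B$ be finite-dimensional C$^*$-algebras, $\mathcal A$ commutative, with faithful positive traces $d$ on $\mathcal A$ and $\tau$ on $\mathcal B$, and let $\mathfrak F:\mathcal A\to\mathcal B$ be a linear bijection with $\tau(\mathfrak F(x)^*\mathfrak F(y))=d(x^*y)$ for all $x,y\in\mathcal A$. The quintuple $(\mathcal A,\mathcal B,\mathfrak F,d,\tau)$ is a fusion bialgebra if (1) $\mathfrak F^{-1}(\mathfrak F(x)\mathfrak F(y))\ge 0$ for all $x,y\ge 0$ in $\mathcal A$; (2) $J(x)=\mathfrak F^{-1}(\mathfrak F(x)^*)$ is a conjugate-linear $*$-isomorphism of $\mathcal A$; (3) $\mathfrak F^{-1}(1)$ is a positive multiple of a minimal projection of $\mathcal A$. Put $\kappa=d(\mathfrak F^{-1}(1))>0$; $\kappa=1$ if the fusion bialgebra is canonical, i.e. if moreover $\mathfrak F^{-1}(1)$ is a minimal projection and $d(\mathfrak F^{-1}(1))=1$. Assume that $d$ is, up to the gauge factor $\kappa$, the Frobenius--Perron dimension: $d(\mathfrak F^{-1}(b))=\kappa\,\|b\|$, with $\|b\|$ the operator norm, for every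 $b\in\mathcal B$ such that $\mathfrak F^{-1}(b)$ is a positive multiple of a minimal projection of $\mathcal A$. For $x\in\mathcal A$ let $\|x\|_2=d(x^*x)^{1/2}$, $H(|x|^2)=-d(x^*x\log x^*x)$, and for $y\in\mathcal B$ let $H(|y|^2)=-\tau(y^*y\log y^*y)$, where $0\log 0=0$. Theorem (Hirschman--Beckner uncertainty principle). For every such fusion bialgebra and every $x\in\mathcal A$, $$H(|x|^2)+H(|\mathfrak F(x)|^2)\ \ge\ -4\|x\|_2^2\log\|x\|_2+2\|x\|_2^2\log\kappa .$$ In particular, if $\kappa\ge 1$ (for example, if the fusion bialgebra is canonical), then $$H(|x|^2)+H(|\mathfrak F(x)|^2)\ \ge\ -4\|x\|_2^2\log\|x\|_2 .$$ -/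

import Mathlib

open scoped ComplexOrder

noncomputable section

/-- A faithful (positive) trace on a C⋆-algebra. -/
structure IsFaithfulTrace {A : Type*} [CStarAlgebra A] (φ : A →ₗ[ℂ] ℂ) : Prop where
  nonneg : ∀ x : A, 0 ≤ φ (star x * x)
  faithful : ∀ x : A, φ (star x * x) = 0 → x = 0
  tracial : ∀ x y : A, φ (x * y) = φ (y * x)

/-- A minimal projection: a nonzero self-adjoint idempotent `p` such that the only
projections `q ≤ p` (that is, `q * p = q`) are `0` and `p`. -/
structure IsMinimalProjection {A : Type*} [CStarAlgebra A] (p : A) : Prop where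
  isStarProjection : IsStarProjection p
  ne_zero : p ≠ 0
  minimal : ∀ q : A, IsStarProjection q → q * p = q → q = 0 ∨ q = p

/-- The convolution `x ∗ y = 𝔉⁻¹ (𝔉 x * 𝔉 y)`. -/
def fourierConv {A B : Type*} [CommCStarAlgebra A] [CStarAlgebra B]
    (F : A ≃ₗ[ℂ] B) (x y : A) : A :=
  F.symm (F x * F y)

/-- The modular conjugation `J x = 𝔉⁻¹ ((𝔉 x)⋆)`. It is conjugate-linear and bijective
for every linear bijection `𝔉`. -/
def modularConj {A B : Type*} [CommCStarAlgebra A] [CStarAlgebra B]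
    (F : A ≃ₗ[ℂ] B) : A ≃ₗ⋆[ℂ] A :=
  (F.trans (starLinearEquiv ℂ (A := B))).trans F.symm

/-- A fusion bialgebra `(A, B, 𝔉, d, τ)`. The order on `A` is the order of the
C⋆-algebra, by the assumption `StarOrderedRing A`. -/
structure FusionBialgebra (A B : Type*)
    [CommCStarAlgebra A] [PartialOrder A] [StarOrderedRing A] [FiniteDimensional ℂ A]
    [CStarAlgebra B] [FiniteDimensional ℂ B] where
  /-- The Fourier transform. -/
  F : A ≃ₗ[ℂ] B
  /-- The faithful trace on `A`. -/
  d : A →ₗ[ℂ] ℂ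
  /-- The faithful trace on `B`. -/
  τ : B →ₗ[ℂ] ℂ
  d_trace : IsFaithfulTrace d
  τ_trace : IsFaithfulTrace τ
  unitary : ∀ x y : A, τ (star (F x) * F y) = d (star x * y)
  schur : ∀ x y : A, 0 ≤ x → 0 ≤ y → 0 ≤ fourierConv F x y
  modular_mul : ∀ x y : A, modularConj F (x * y) = modularConj F x * modularConj F y
  modular_star : ∀ x : A, modularConj F (star x) = star (modularConj F x)
  jones : ∃ (c : ℝ) (p : A), 0 < c ∧ IsMinimalProjection p ∧ F.symm 1 = (c : ℂ) • p

/-- The constant `d (𝔉⁻¹ 1)`, a positive real number. It is `1` if the fusion bialgebra is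
canonical, and a gauge transformation `(√(s/t) 𝔉, s d, t τ)` multiplies it by `√(s t)`. -/
def FusionBialgebra.scale {A B : Type*}
    [CommCStarAlgebra A] [PartialOrder A] [StarOrderedRing A] [FiniteDimensional ℂ A]
    [CStarAlgebra B] [FiniteDimensional ℂ B] (Φ : FusionBialgebra A B) : ℝ :=
  (Φ.d (Φ.F.symm 1)).re

/-- `d` is, up to a gauge transformation, the Frobenius-Perron dimension: on the basis of `B`
that consists of multiples `b = r • 𝔉 p` (`r > 0`) of the images of the minimal projections `p`
of `A`, `d (𝔉⁻¹ b)` is the operator norm of `b`, up to the factor `d (𝔉⁻¹ 1)`, which makes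
the value at the basis element `1` correct. Both sides are homogeneous in `b`, so that the
condition may be stated for `b = 𝔉 p`. -/
def FusionBialgebra.IsFrobeniusPerron {A B : Type*}
    [CommCStarAlgebra A] [PartialOrder A] [StarOrderedRing A] [FiniteDimensional ℂ A]
    [CStarAlgebra B] [FiniteDimensional ℂ B] (Φ : FusionBialgebra A B) : Prop :=
  ∀ p : A, IsMinimalProjection p → (Φ.d p).re = Φ.scale * ‖Φ.F p‖

/-- The norm `‖x‖₂ = φ(|x|²)^(1/2)` of a trace `φ`. -/
def traceNorm {A : Type*} [CStarAlgebra A] (φ : A →ₗ[ℂ] ℂ) (x : A) : ℝ :=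
  √(φ (star x * x)).re

/-- The von Neumann entropy `H(|x|²) = -φ(x⋆x log(x⋆x))` with respect to a trace `φ`, where
`-a log a` is the continuous functional calculus of `t ↦ -t log t` (with value `0` at `0`). -/
def vnEntropy {A : Type*} [CStarAlgebra A] (φ : A →ₗ[ℂ] ℂ) (x : A) : ℝ :=
  (φ (cfc Real.negMulLog (star x * x))).re

end

/-! Complex interpolation, differentiated at an endpoint. With `y = F x`, `N = ‖x‖₂²` and κ the
scale, consider the entire function f(z) = τ(|y|^z y⋆ F(|x|^z x)). It takes the value N at 0, and
f'(0) is minus half the sum of the two entropies.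

On Re z = 0 the powers only introduce phases, so Cauchy-Schwarz and unitarity of `F` give |f| ≤ N.
On Re z = 1, Cauchy-Schwarz gives |f| ≤ N ‖F(|x|^z x)‖. The Frobenius-Perron condition yields the L¹
to L^∞ bound for `F`, so that norm is at most N / κ.

The three lines theorem gives Re f(s) ≤ N^(1-s) (N²/κ)^s on [0, 1], with equality at s = 0.
Comparing derivatives there gives the entropy inequality. In finite dimension f is a finite
exponential sum over the spectral projections of y⋆y and the minimal projections of A
(`re_sum_mul_le_of_strip_bounds`). -/

/-! ### The three lines theorem and its derivative at the edge -/

/-- A one-sided first-order comparison: `g ≤ h` on `[0, 1]` and `g 0 = h 0` give `g' 0 ≤ h' 0`. -/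
theorem HasDerivAt.le_of_le_on_Icc {g h : ℝ → ℝ} {g' h' : ℝ} (hg : HasDerivAt g g' 0)
    (hh : HasDerivAt h h' 0) (h0 : g 0 = h 0) (hle : ∀ s ∈ Set.Icc (0 : ℝ) 1, g s ≤ h s) :
    g' ≤ h' := by
  have hd := (hh.sub hg).hasDerivWithinAt (s := Set.Ioi 0)
  rw [hasDerivWithinAt_iff_tendsto_slope' (by simp)] at hd
  have : 0 ≤ h' - g' := by
    refine ge_of_tendsto hd ?_
    filter_upwards [Ioc_mem_nhdsGT (zero_lt_one' ℝ)] with s hs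
    have := hle s ⟨hs.1.le, hs.2⟩
    rw [slope_def_field]
    apply div_nonneg <;> simp <;> linarith [hs.1]
  linarith

/-- An exponential sum with `f 0 = N`, bounded by `N` on the imaginary axis and by `M` on the
line `re z = 1`, satisfies `re f' 0 ≤ N log (M / N)`. -/
theorem re_sum_mul_le_of_strip_bounds {ι : Type*} [Fintype ι] (c : ι → ℂ) (l : ι → ℝ) {N M : ℝ}
    (hN : 0 < N) (hM : 0 < M) (hsum : ∑ i, c i = N)
    (h0 : ∀ z : ℂ, z.re = 0 → ‖∑ i, c i * Complex.exp (z * l i)‖ ≤ N)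
    (h1 : ∀ z : ℂ, z.re = 1 → ‖∑ i, c i * Complex.exp (z * l i)‖ ≤ M) :
    (∑ i, c i * l i).re ≤ N * (Real.log M - Real.log N) := by
  set f : ℂ → ℂ := fun z ↦ ∑ i, c i * Complex.exp (z * l i) with hf
  have hfd (z : ℂ) : HasDerivAt f (∑ i, c i * (Complex.exp (z * l i) * l i)) z := by
    refine HasDerivAt.fun_sum fun i _ ↦ HasDerivAt.const_mul _ ?_
    simpa using ((hasDerivAt_id z).mul_const (l i : ℂ)).cexp
  -- The frequencies `l i` are real, so each exponential has modulus depending only on `z.re`, which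
  -- lies in [0, 1].
  have hB : BddAbove ((norm ∘ f) '' Complex.HadamardThreeLines.verticalClosedStrip 0 1) := by
    refine ⟨∑ i, ‖c i‖ * Real.exp |l i|, ?_⟩
    rintro _ ⟨z, hz, rfl⟩
    refine (norm_sum_le _ _).trans (Finset.sum_le_sum fun i _ ↦ ?_)
    rw [norm_mul, Complex.norm_exp]
    gcongr
    have hz' : 0 ≤ z.re ∧ z.re ≤ 1 := hz
    simp only [Complex.mul_re, Complex.ofReal_re, Complex.ofReal_im, mul_zero, sub_zero]
    calc z.re * l i ≤ z.re * |l i| := by gcongr; exacts [hz'.1, le_abs_self _]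
      _ ≤ 1 * |l i| := by gcongr; exact hz'.2
      _ = |l i| := one_mul _
  have key : ∀ s ∈ Set.Icc (0 : ℝ) 1, (f s).re ≤ N ^ (1 - s) * M ^ s := by
    intro s hs
    have := Complex.HadamardThreeLines.norm_le_interp_of_mem_verticalClosedStrip'
      (f := f) (z := (s : ℂ)) (a := N) (b := M) zero_lt_one (by simpa
        [Complex.HadamardThreeLines.verticalClosedStrip] using hs)
      (Differentiable.diffContOnCl fun z ↦ (hfd z).differentiableAt) hB
      (fun z hz ↦ h0 z hz) (fun z hz ↦ h1 z hz)
    simp only [Complex.ofReal_re, sub_zero, div_one] at this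
    exact (Complex.re_le_norm _).trans this
  have hg : HasDerivAt (fun s : ℝ ↦ (f s).re) (∑ i, c i * l i).re 0 := by
    have := (hfd ((0 : ℝ) : ℂ)).real_of_complex
    simpa using this
  have hh : HasDerivAt (fun s : ℝ ↦ N ^ (1 - s) * M ^ s) (N * (Real.log M - Real.log N)) 0 := by
    have h1 : HasDerivAt (fun s : ℝ ↦ N ^ (1 - s)) (Real.log N * (-1) * N ^ (1 - (0 : ℝ))) 0 :=
      ((hasDerivAt_id (0 : ℝ)).const_sub 1).const_rpow hN
    have h2 : HasDerivAt (fun s : ℝ ↦ M ^ s) (Real.log M * 1 * M ^ (0 : ℝ)) 0 :=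
      (hasDerivAt_id (0 : ℝ)).const_rpow hM
    refine (h1.mul h2).congr_deriv ?_
    simp only [sub_zero, Real.rpow_one, Real.rpow_zero]
    ring
  exact hg.le_of_le_on_Icc hh (by simp [hf, hsum]) key

/-! ### Inequalities for a faithful trace -/

section Trace

variable {B : Type*} [CStarAlgebra B] {τ : B →ₗ[ℂ] ℂ}

/-- Polarization: positivity makes τ real on u⋆u, and u = 1 + w, u = 1 + iw give the imaginary and
real parts of the identity. -/
theorem IsFaithfulTrace.map_star (hτ : IsFaithfulTrace τ) (w : B) :
    τ (star w) = star (τ w) := by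
  have h0 := (Complex.nonneg_iff.1 (hτ.nonneg 1)).2
  have hw := (Complex.nonneg_iff.1 (hτ.nonneg w)).2
  have h1 := (Complex.nonneg_iff.1 (hτ.nonneg (1 + w))).2
  have h2 := (Complex.nonneg_iff.1 (hτ.nonneg (1 + Complex.I • w))).2
  simp only [star_add, star_one, star_smul, add_mul, mul_add, one_mul, mul_one, map_add,
    smul_mul_assoc, mul_smul_comm, map_smul, smul_eq_mul, Complex.add_im] at h0 h1 h2
  simp at h0 h2
  apply Complex.ext
  · simp; linarith
  · simp; linarith

/-- The Cauchy-Schwarz inequality for a trace. -/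
theorem IsFaithfulTrace.norm_map_star_mul_le (hτ : IsFaithfulTrace τ) (u v : B) :
    ‖τ (star u * v)‖ ≤ √(τ (star u * u)).re * √(τ (star v * v)).re := by
  let core : PreInnerProductSpace.Core ℂ B :=
    { inner := fun u v ↦ τ (star u * v)
      conj_inner_symm := fun u v ↦ by
        have := hτ.map_star (star v * u)
        rw [star_mul, star_star] at this
        rw [this]; simp
      re_inner_nonneg := fun u ↦ (Complex.nonneg_iff.1 (hτ.nonneg u)).1
      add_left := fun u v w ↦ by simp [add_mul]
      smul_left := fun u v c ↦ by simp }
  exact InnerProductSpace.Core.norm_inner_le_norm (c := core) u v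

/-- The element ‖G‖² - G G⋆ is positive, hence of the form w⋆w; then τ((wy)⋆(wy)) ≥ 0 is the claim
after a cyclic permutation. -/
theorem IsFaithfulTrace.re_map_conj_le (hτ : IsFaithfulTrace τ) (y G : B) :
    (τ (star (star y * G) * (star y * G))).re ≤ ‖G‖ ^ 2 * (τ (star y * y)).re := by
  let _ := CStarAlgebra.spectralOrder B
  have _ := CStarAlgebra.spectralOrderedRing B
  have hle : G * star G ≤ algebraMap ℝ B (‖G‖ ^ 2) := CStarAlgebra.mul_star_le_algebraMap_norm_sq
  obtain ⟨w, hw⟩ := CStarAlgebra.nonneg_iff_eq_star_mul_self.1 (sub_nonneg.2 hle)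
  have h := (Complex.nonneg_iff.1 (hτ.nonneg (w * y))).1
  have e1 : star (w * y) * (w * y) =
      ((‖G‖ ^ 2 : ℝ) : ℂ) • (star y * y) - star y * (G * star G) * y := by
    have : star (w * y) * (w * y) = star y * (star w * w) * y := by
      simp only [star_mul, mul_assoc]
    rw [this, ← hw, mul_sub, sub_mul, Algebra.algebraMap_eq_smul_one,
      mul_smul_one, smul_mul_assoc, Complex.coe_smul]
  have e2 : τ (star (star y * G) * (star y * G)) = τ (star y * (G * star G) * y) := by
    rw [star_mul, star_star, mul_assoc, hτ.tracial, hτ.tracial (_ * _) y]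
    rw [hτ.tracial y]
    simp only [mul_assoc]
    rw [hτ.tracial y]
    simp only [mul_assoc]
  rw [e2]
  rw [e1, map_sub, map_smul, Complex.sub_re, smul_eq_mul, Complex.re_ofReal_mul] at h
  linarith

theorem IsFaithfulTrace.map_isStarProjection (hτ : IsFaithfulTrace τ) {p : B}
    (hp : IsStarProjection p) : τ p = ((τ p).re : ℂ) ∧ 0 ≤ (τ p).re := by
  have h := hτ.nonneg p
  rw [hp.isSelfAdjoint.star_eq, hp.isIdempotentElem.eq] at h
  exact ⟨Complex.ext rfl (by simpa using (Complex.nonneg_iff.1 h).2.symm),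
    (Complex.nonneg_iff.1 h).1⟩

end Trace

/-! ### Spectral resolutions and minimal projections -/

section Resolution

/-- A finite family of mutually orthogonal projections with sum `1`. -/
structure IsProjectionResolution {B ι : Type*} [CStarAlgebra B] [Fintype ι] (q : ι → B) : Prop where
  isStarProjection : ∀ i, IsStarProjection (q i)
  ortho : ∀ i j, i ≠ j → q i * q j = 0
  sum_eq_one : ∑ i, q i = 1

namespace IsProjectionResolution

variable {B ι : Type*} [CStarAlgebra B] [Fintype ι] {q : ι → B}

theorem sum_smul_mul (hq : IsProjectionResolution q) (c : ι → ℂ) (j : ι) :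
    (∑ i, c i • q i) * q j = c j • q j := by
  rw [Finset.sum_mul, Finset.sum_eq_single j]
  · rw [smul_mul_assoc, (hq.isStarProjection j).isIdempotentElem.eq]
  · intro i _ hij
    rw [smul_mul_assoc, hq.ortho i j hij, smul_zero]
  · simp

theorem sum_smul_mul_sum_smul (hq : IsProjectionResolution q) (c c' : ι → ℂ) :
    (∑ i, c i • q i) * (∑ i, c' i • q i) = ∑ i, (c i * c' i) • q i := by
  rw [Finset.mul_sum]
  refine Finset.sum_congr rfl fun j _ ↦ ?_
  rw [mul_smul_comm, hq.sum_smul_mul, smul_smul, mul_comm]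

theorem star_sum_smul (hq : IsProjectionResolution q) (c : ι → ℂ) :
    star (∑ i, c i • q i) = ∑ i, star (c i) • q i := by
  simp [star_sum, (hq.isStarProjection _).isSelfAdjoint.star_eq]

end IsProjectionResolution

/-- The spectrum of an element of a finite-dimensional algebra is finite. -/
theorem spectrum_real_finite {B : Type*} [CStarAlgebra B] [FiniteDimensional ℂ B] (b : B) :
    (spectrum ℝ b).Finite := by
  cases subsingleton_or_nontrivial B
  · simp [spectrum.of_subsingleton]
  have : FiniteDimensional ℝ B := FiniteDimensional.complexToReal B
  have hb : IsIntegral ℝ b := Algebra.IsIntegral.isIntegral b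
  refine ((minpoly ℝ b).rootSet_finite ℝ).subset fun t ht ↦ ?_
  rw [Polynomial.mem_rootSet]
  refine ⟨minpoly.ne_zero hb, ?_⟩
  have := spectrum.subset_polynomial_aeval b (minpoly ℝ b) ⟨t, ht, rfl⟩
  rw [minpoly.aeval, spectrum.zero_eq] at this
  simpa using this

/-- The spectral resolution of a self-adjoint element of a finite-dimensional C⋆-algebra. -/
theorem exists_spectral_resolution {B : Type*} [CStarAlgebra B] [FiniteDimensional ℂ B] {b : B}
    (hb : IsSelfAdjoint b) :
    ∃ (κ : Type) (_ : Fintype κ) (t : κ → ℝ) (q : κ → B), (∀ k, t k ∈ spectrum ℝ b) ∧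
      IsProjectionResolution q ∧ ∀ f : ℝ → ℝ, cfc f b = ∑ k, (f (t k) : ℂ) • q k := by
  have hfin := spectrum_real_finite b
  have hc (f : ℝ → ℝ) : ContinuousOn f (spectrum ℝ b) := hfin.continuousOn f
  let _ : Fintype (spectrum ℝ b) := hfin.fintype
  classical
  -- Point indicators are continuous on the finite spectrum, so the functional calculus turns them
  -- into the spectral projections.
  let g (t : spectrum ℝ b) : ℝ → ℝ := fun s ↦ if s = t then 1 else 0
  have hcfc (f : ℝ → ℝ) : cfc f b = ∑ t : spectrum ℝ b, (f t : ℂ) • cfc (g t) b := by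
    have h1 : (spectrum ℝ b).EqOn f (∑ t : spectrum ℝ b, fun s ↦ f t • g t s) := by
      intro s hs
      rw [Finset.sum_apply, Finset.sum_eq_single ⟨s, hs⟩]
      · simp [g]
      · intro t _ ht
        have : s ≠ t := fun h ↦ ht (Subtype.ext h.symm)
        simp [g, this]
      · simp
    rw [cfc_congr h1, cfc_sum_univ _ _ fun _ ↦ hc _]
    refine Finset.sum_congr rfl fun t _ ↦ ?_
    rw [cfc_smul _ _ _ (hc _)]
    simp
  refine ⟨spectrum ℝ b, inferInstance, (↑), fun t ↦ cfc (g t) b, fun t ↦ t.2,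
    ⟨fun t ↦ ⟨?_, cfc_predicate _ _⟩, fun t u h ↦ ?_, ?_⟩, hcfc⟩
  · rw [IsIdempotentElem, ← cfc_mul _ _ _ (hc _) (hc _)]
    congr 1
    ext s
    simp [g]
  · rw [← cfc_mul _ _ _ (hc _) (hc _)]
    have : (fun s ↦ g t s * g u s) = 0 := by
      ext s
      have : (t : ℝ) ≠ u := fun h' ↦ h (Subtype.ext h')
      by_cases hs : s = t
      · simp [g, hs, this]
      · simp [g, hs]
    rw [this, cfc_zero]
  · have := hcfc (fun _ ↦ 1)
    rw [cfc_const_one ℝ b] at this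
    simpa using this.symm

open WeakDual in
-- Distinct characters are linearly independent (Dedekind), so a finite-dimensional algebra has
-- finitely many.
theorem finite_characterSpace (A : Type*) [CommCStarAlgebra A] [FiniteDimensional ℂ A] :
    Finite (characterSpace ℂ A) := by
  have h := linearIndependent_algHom_toLinearMap ℂ A ℂ
  have : Finite (A →ₐ[ℂ] ℂ) := h.finite
  refine Finite.of_injective (β := A →ₐ[ℂ] ℂ) (fun χ ↦ CharacterSpace.toAlgHom χ) ?_
  intro χ ψ h
  ext a
  exact DFunLike.congr_fun h a

universe u in
/-- A finite-dimensional commutative C⋆-algebra is spanned by its minimal projections. -/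
theorem exists_minimalProjection_resolution (A : Type u) [CommCStarAlgebra A]
    [FiniteDimensional ℂ A] :
    ∃ (ι : Type u) (_ : Fintype ι) (e : ι → A) (χ : ι → A → ℂ), IsProjectionResolution e ∧
      (∀ i, IsMinimalProjection (e i)) ∧ (∀ x, x = ∑ i, χ i x • e i) ∧
      ∀ (x : A) (f : ℝ → ℝ), cfc f (star x * x) = ∑ i, (f (‖χ i x‖ ^ 2) : ℂ) • e i := by
  have : Finite (WeakDual.characterSpace ℂ A) := finite_characterSpace A
  let _ : Fintype (WeakDual.characterSpace ℂ A) := Fintype.ofFinite _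
  classical
  -- The Gelfand preimage of the indicator of the point χ.
  let e (χ : WeakDual.characterSpace ℂ A) : A :=
    (gelfandStarTransform A).symm ⟨Pi.single χ 1, continuous_of_discreteTopology⟩
  have happly (χ : WeakDual.characterSpace ℂ A) (a : A) : gelfandStarTransform A a χ = χ a := rfl
  have hext {a b : A} (h : ∀ χ : WeakDual.characterSpace ℂ A, χ a = χ b) : a = b :=
    (gelfandStarTransform A).injective (ContinuousMap.ext h)
  have he (χ ψ : WeakDual.characterSpace ℂ A) : ψ (e χ) = if ψ = χ then 1 else 0 := by
    rw [← happly, StarAlgEquiv.apply_symm_apply]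
    simp [Pi.single_apply]
  have hsum (ψ : WeakDual.characterSpace ℂ A) (c : WeakDual.characterSpace ℂ A → ℂ) :
      ψ (∑ χ, c χ • e χ) = c ψ := by
    simp [map_sum, he]
  have hstar (χ : WeakDual.characterSpace ℂ A) (a : A) : χ (star a) = star (χ a) := map_star χ a
  have hproj (χ) : IsStarProjection (e χ) := by
    refine ⟨hext fun ψ ↦ ?_, hext fun ψ ↦ ?_⟩
    · simp [he]
    · rw [hstar, he]; split_ifs <;> simp
  refine ⟨WeakDual.characterSpace ℂ A, inferInstance, e, fun χ x ↦ χ x,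
    ⟨hproj, fun χ χ' h ↦ hext fun ψ ↦ ?_, hext fun ψ ↦ ?_⟩, fun χ ↦ ⟨hproj χ, ?_, fun p hp hpe ↦ ?_⟩,
    fun x ↦ hext fun ψ ↦ (hsum ψ fun χ ↦ χ x).symm, fun x f ↦ hext fun ψ ↦ ?_⟩
  · by_cases h1 : ψ = χ
    · have : ψ ≠ χ' := fun h2 ↦ h (h1.symm.trans h2)
      simp [he, this]
    · simp [he, h1]
  · simp [he, map_sum]
  · intro h
    have := he χ χ
    simp [h] at this
  · have hid : χ p * χ p = χ p := by rw [← map_mul, hp.isIdempotentElem.eq]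
    have h01 : χ p = 0 ∨ χ p = 1 := by
      rcases eq_or_ne (χ p) 0 with h | h
      · exact .inl h
      · exact .inr (mul_left_cancel₀ h (by rw [hid, mul_one]))
    have hz (ψ) (h : ψ ≠ χ) : ψ p = 0 := by
      rw [← hpe, map_mul, he, if_neg h, mul_zero]
    rcases h01 with h | h
    · refine .inl (hext fun ψ ↦ ?_)
      by_cases hψ : ψ = χ
      · rw [hψ, h, map_zero]
      · rw [hz ψ hψ, map_zero]
    · refine .inr (hext fun ψ ↦ ?_)
      by_cases hψ : ψ = χ
      · rw [hψ, h, he, if_pos rfl]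
      · rw [hz ψ hψ, he, if_neg hψ]
  · rw [hsum]
    have hfin := spectrum_real_finite (star x * x)
    have h1 := StarAlgHomClass.map_cfc (S := ℂ) (R := ℝ) ψ f (star x * x) (hfin.continuousOn f)
      (map_continuous ψ) (.star_mul_self x) (by
        rw [map_mul, hstar]; exact .star_mul_self _)
    rw [h1, map_mul, hstar]
    have h2 : star (ψ x) * ψ x = algebraMap ℝ ℂ (‖ψ x‖ ^ 2) := by
      simp [← Complex.normSq_eq_norm_sq, Complex.normSq_eq_conj_mul_self]
    rw [h2, cfc_algebraMap]
    rfl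

end Resolution

/-! ### Bounds on the two edges of the strip -/

section TraceBounds

variable {B κ : Type*} [CStarAlgebra B] {τ : B →ₗ[ℂ] ℂ} [Fintype κ] {q : κ → B}

/-- Unimodular coefficients make the sum a unitary U, and replacing y by y U⋆ in Cauchy-Schwarz
leaves its trace norm unchanged. -/
theorem IsProjectionResolution.norm_map_mul_le_of_norm_eq_one (hq : IsProjectionResolution q)
    (hτ : IsFaithfulTrace τ) (y v : B) {α : κ → ℂ} (hα : ∀ k, ‖α k‖ = 1) :
    ‖τ ((∑ k, α k • q k) * star y * v)‖ ≤ √(τ (star y * y)).re * √(τ (star v * v)).re := by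
  set U := ∑ k, α k • q k with hU
  have h := hτ.norm_map_star_mul_le (y * star U) v
  have hUU : star U * U = 1 := by
    rw [hU, hq.star_sum_smul, hq.sum_smul_mul_sum_smul, ← hq.sum_eq_one]
    refine Finset.sum_congr rfl fun k _ ↦ ?_
    have : star (α k) * α k = 1 := by
      rw [Complex.star_def, ← Complex.normSq_eq_conj_mul_self, Complex.normSq_eq_norm_sq, hα]
      simp
    rw [this, one_smul]
  have e1 : τ (star (y * star U) * (y * star U)) = τ (star y * y) := by
    rw [star_mul, star_star, mul_assoc, hτ.tracial]
    congr 1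
    rw [mul_assoc, mul_assoc, hUU, mul_one]
  rwa [e1, star_mul, star_star] at h

/-- Here the sum acts as R with R R⋆ = y⋆y; Cauchy-Schwarz applies to the factors R and y⋆G.
Coefficients at t k = 0 are free because they multiply q k y⋆ = 0. -/
theorem IsProjectionResolution.norm_map_mul_le_of_norm_sq_eq (hq : IsProjectionResolution q)
    (hτ : IsFaithfulTrace τ) {y : B} {t : κ → ℝ} (hy : star y * y = ∑ k, (t k : ℂ) • q k) (G : B)
    {α : κ → ℂ} (hα : ∀ k, t k ≠ 0 → ‖α k‖ ^ 2 = t k) :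
    ‖τ ((∑ k, α k • q k) * star y * G)‖ ≤ (τ (star y * y)).re * ‖G‖ := by
  classical
  set α' : κ → ℂ := fun k ↦ if t k = 0 then 0 else α k with hα'
  have hα'_mul (k : κ) : star (α' k) * α' k = t k := by
    by_cases h : t k = 0
    · simp [hα', h]
    · simp only [hα', h, if_false]
      rw [Complex.star_def, ← Complex.normSq_eq_conj_mul_self, Complex.normSq_eq_norm_sq, hα k h]
  have hz (k : κ) (hk : t k = 0) : q k * star y = 0 := by
    have hs := (hq.isStarProjection k).isSelfAdjoint.star_eq
    have : y * q k = 0 := by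
      rw [← CStarRing.star_mul_self_eq_zero_iff, star_mul, hs, mul_assoc, ← mul_assoc (star y), hy,
        hq.sum_smul_mul, hk]
      simp
    rw [← star_eq_zero, star_mul, star_star, hs, this]
  have hαy : (∑ k, α k • q k) * star y = (∑ k, α' k • q k) * star y := by
    simp only [Finset.sum_mul, smul_mul_assoc]
    refine Finset.sum_congr rfl fun k _ ↦ ?_
    by_cases h : t k = 0
    · simp [hz k h]
    · simp [hα', h]
  set R := ∑ k, α' k • q k with hR
  have h := hτ.norm_map_star_mul_le (star R) (star y * G)
  have e1 : star (star R) * star R = star y * y := by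
    rw [star_star, hR, hq.star_sum_smul, hq.sum_smul_mul_sum_smul, hy]
    refine Finset.sum_congr rfl fun k _ ↦ ?_
    rw [mul_comm, hα'_mul]
  have hN : 0 ≤ (τ (star y * y)).re := (Complex.nonneg_iff.1 (hτ.nonneg y)).1
  rw [e1, star_star, ← mul_assoc, ← hαy] at h
  refine h.trans ?_
  calc √(τ (star y * y)).re * √(τ (star (star y * G) * (star y * G))).re
      ≤ √(τ (star y * y)).re * √(‖G‖ ^ 2 * (τ (star y * y)).re) := by
        gcongr
        exact hτ.re_map_conj_le y G
    _ = (τ (star y * y)).re * ‖G‖ := by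
        rw [Real.sqrt_mul (by positivity), Real.sqrt_sq (norm_nonneg _)]
        linear_combination ‖G‖ * Real.mul_self_sqrt hN

end TraceBounds

/-! ### The entropy inequality for fusion bialgebras -/

namespace FusionBialgebra

variable {A B : Type*} [CommCStarAlgebra A] [PartialOrder A] [StarOrderedRing A]
  [FiniteDimensional ℂ A] [CStarAlgebra B] [FiniteDimensional ℂ B]

theorem scale_pos (Φ : FusionBialgebra A B) : 0 < Φ.scale := by
  obtain ⟨c, p, hc, hp, h⟩ := Φ.jones
  obtain ⟨h1, h2⟩ := Φ.d_trace.map_isStarProjection hp.isStarProjection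
  have h3 : (Φ.d p).re ≠ 0 := by
    intro h0
    apply hp.ne_zero
    apply Φ.d_trace.faithful
    rw [hp.isStarProjection.isSelfAdjoint.star_eq, hp.isStarProjection.isIdempotentElem.eq, h1, h0,
      Complex.ofReal_zero]
  rw [scale, h, map_smul, smul_eq_mul, Complex.re_ofReal_mul]
  exact mul_pos hc (lt_of_le_of_ne h2 h3.symm)

/-- The Hausdorff-Young inequality from `L¹` to `L^∞`. -/
theorem IsFrobeniusPerron.norm_F_sum_smul_le {Φ : FusionBialgebra A B} (hΦ : Φ.IsFrobeniusPerron)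
    {ι : Type*} [Fintype ι] {e : ι → A} (he : ∀ i, IsMinimalProjection (e i)) (w : ι → ℂ) :
    ‖Φ.F (∑ i, w i • e i)‖ ≤ (∑ i, ‖w i‖ * (Φ.d (e i)).re) / Φ.scale := by
  rw [map_sum, Finset.sum_div]
  refine (norm_sum_le _ _).trans (Finset.sum_le_sum fun i _ ↦ ?_)
  rw [map_smul, norm_smul, hΦ _ (he i), mul_div_assoc, mul_div_cancel_left₀ _ Φ.scale_pos.ne']

theorem IsFrobeniusPerron.entropy_add_entropy_ge {Φ : FusionBialgebra A B}
    (hΦ : Φ.IsFrobeniusPerron) {x : A} (hx0 : x ≠ 0) :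
    -2 * (Φ.d (star x * x)).re * (Real.log (Φ.d (star x * x)).re - Real.log Φ.scale) ≤
      vnEntropy Φ.d x + vnEntropy Φ.τ (Φ.F x) := by
  obtain ⟨ι, _, e, χ, he, hmin, hx, hcfcA⟩ := exists_minimalProjection_resolution A
  set y := Φ.F x with hy
  have hysa : IsSelfAdjoint (star y * y) := .star_mul_self y
  obtain ⟨κ, _, t, q, ht, hq, hcfcB⟩ := exists_spectral_resolution hysa
  have ht0 (k : κ) : 0 ≤ t k := spectrum_star_mul_self_nonneg (t k) (ht k)
  set δ : ι → ℝ := fun i ↦ (Φ.d (e i)).re with hδ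
  have hdδ (i : ι) : Φ.d (e i) = δ i :=
    (Φ.d_trace.map_isStarProjection (he.isStarProjection i)).1
  set n : ι → ℝ := fun i ↦ ‖χ i x‖ ^ 2 with hn
  have hχ (i : ι) : star (χ i x) * χ i x = n i := by
    rw [Complex.star_def, ← Complex.normSq_eq_conj_mul_self, Complex.normSq_eq_norm_sq]
  have hyy : star y * y = ∑ k, (t k : ℂ) • q k := by
    rw [← cfc_id ℝ (star y * y) hysa, hcfcB]; rfl
  have hxx : star x * x = ∑ i, (n i : ℂ) • e i := by
    rw [← cfc_id ℝ (star x * x) (.star_mul_self x), hcfcA]; rfl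
  set N := (Φ.d (star x * x)).re with hN
  have hdx : Φ.d (star x * x) = N :=
    Complex.ext rfl (by simpa using (Complex.nonneg_iff.1 (Φ.d_trace.nonneg x)).2.symm)
  have hτy : Φ.τ (star y * y) = N := by rw [hy, Φ.unitary, hdx]
  have hN0 : 0 < N := by
    refine lt_of_le_of_ne (Complex.nonneg_iff.1 (Φ.d_trace.nonneg x)).1 fun h ↦ hx0 ?_
    apply Φ.d_trace.faithful
    rw [hdx, ← h, Complex.ofReal_zero]
  have hNsum : ∑ i, n i * δ i = N := by
    rw [hN, hxx]
    simp [map_sum, hδ]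
  have hbil (α : κ → ℂ) (β : ι → ℂ) :
      Φ.τ ((∑ k, α k • q k) * star y * Φ.F (∑ i, β i • e i)) =
        ∑ k : κ × ι,
          α k.1 * β k.2 * Φ.τ (q k.1 * star y * Φ.F (e k.2)) := by
    simp only [map_sum, map_smul, Finset.sum_mul, Finset.mul_sum, smul_mul_assoc, mul_smul_comm,
      smul_eq_mul, Fintype.sum_prod_type]
    rw [Finset.sum_comm]
    refine Finset.sum_congr rfl fun k _ ↦ Finset.sum_congr rfl fun i _ ↦ ?_
    ring
  have hstar_x : star x = ∑ i, star (χ i x) • e i := by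
    rw [← he.star_sum_smul, ← hx x]
  have hd_mul (β : ι → ℝ) : Φ.τ (star y * Φ.F (∑ i, (β i * χ i x) • e i)) =
      ∑ i, (β i * (n i * δ i) : ℝ) := by
    rw [hy, Φ.unitary]
    rw [hstar_x, he.sum_smul_mul_sum_smul, map_sum]
    push_cast
    refine Finset.sum_congr rfl fun i _ ↦ ?_
    rw [map_smul, hdδ, smul_eq_mul, ← hχ]
    ring
  let c : κ × ι → ℂ := fun k ↦
    χ k.2 x * Φ.τ (q k.1 * star y * Φ.F (e k.2))
  -- The convention log 0 = 0 turns 0^z into 1. This is harmless: `c` vanishes at such indices,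
  -- since q k y⋆ = 0 when t k = 0 and χ i x = 0 when n i = 0.
  let l : κ × ι → ℝ := fun k ↦ Real.log (t k.1) / 2 + Real.log (n k.2) / 2
  have hf (z : ℂ) : ∑ k, c k * Complex.exp (z * l k) =
      Φ.τ ((∑ k, Complex.exp (z * (Real.log (t k) / 2 : ℝ)) • q k) * star y *
        Φ.F (∑ i, (Complex.exp (z * (Real.log (n i) / 2 : ℝ)) * χ i x) • e i)) := by
    rw [hbil]
    refine Finset.sum_congr rfl fun k _ ↦ ?_
    simp only [c, l, Complex.ofReal_add, mul_add, Complex.exp_add]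
    ring
  have hnorm (z : ℂ) (s : ℝ) :
      ‖Complex.exp (z * (Real.log s / 2 : ℝ))‖ = Real.exp (z.re * (Real.log s / 2)) := by
    rw [Complex.norm_exp, mul_comm, Complex.re_ofReal_mul, mul_comm]
  have hsq {z : ℂ} (hz : z.re = 1) {s : ℝ} (hs : 0 < s) :
      ‖Complex.exp (z * (Real.log s / 2 : ℝ))‖ = √s := by
    rw [hnorm, hz, one_mul, Real.exp_half, Real.exp_log hs]
  have hone : ∑ k, c k = N := by
    have := hf 0
    simp only [zero_mul, Complex.exp_zero, mul_one, one_smul, one_mul, hq.sum_eq_one] at this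
    rw [this, ← hx x, ← hτy]
  -- Each half of `l` depends on one index only, so the sum over the other index collapses, to x or
  -- to 1.
  have hder : (∑ k, c k * l k).re = -(vnEntropy Φ.d x + vnEntropy Φ.τ y) / 2 := by
    have h1 := hbil (fun k ↦ (Real.log (t k) / 2 : ℝ)) (fun i ↦ χ i x)
    have h2 := hbil (fun _ ↦ 1) (fun i ↦ (Real.log (n i) / 2 : ℝ) * χ i x)
    rw [← hx x, mul_assoc, ← hy, hyy, hq.sum_smul_mul_sum_smul, map_sum] at h1
    simp only [one_smul, hq.sum_eq_one, one_mul] at h2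
    rw [hd_mul] at h2
    have h3 : ∑ k, c k * l k =
        ∑ k, ((Real.log (t k) / 2 : ℝ) * t k : ℂ) * Φ.τ (q k) +
          (∑ i, Real.log (n i) / 2 * (n i * δ i) : ℝ) := by
      rw [h2]
      simp only [map_smul, smul_eq_mul] at h1
      rw [h1, ← Finset.sum_add_distrib]
      refine Finset.sum_congr rfl fun k _ ↦ ?_
      simp only [c, l]
      push_cast
      ring
    rw [h3, vnEntropy, vnEntropy, hcfcA, hcfcB, map_sum, map_sum, Complex.add_re, Complex.re_sum,
      Complex.re_sum, Complex.re_sum, Complex.ofReal_re]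
    simp only [map_smul, smul_eq_mul, Complex.re_ofReal_mul, ← Complex.ofReal_mul, hdδ,
      Complex.ofReal_re, Real.negMulLog]
    rw [neg_div, add_div, neg_add, add_comm, Finset.sum_div, Finset.sum_div,
      ← Finset.sum_neg_distrib, ← Finset.sum_neg_distrib]
    congr 1 <;> refine Finset.sum_congr rfl fun k _ ↦ ?_
    · change Real.log (n k) / 2 * (n k * δ k) = -(-n k * Real.log (n k) * δ k / 2)
      ring
    · ring
  -- On Re z = 1 one factor N comes from y, the other factor N / κ from the L¹ norm of |x|² divided
  -- by the scale.
  have := re_sum_mul_le_of_strip_bounds c l hN0 (M := N ^ 2 / Φ.scale)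
    (div_pos (by positivity) Φ.scale_pos) hone (fun z hz ↦ ?_) (fun z hz ↦ ?_)
  · rw [hder, Real.log_div (by positivity) Φ.scale_pos.ne', Real.log_pow] at this
    push_cast at this
    nlinarith
  · rw [hf]
    refine (hq.norm_map_mul_le_of_norm_eq_one Φ.τ_trace y _ fun k ↦ ?_).trans ?_
    · rw [hnorm, hz, zero_mul, Real.exp_zero]
    · set w := ∑ i, (Complex.exp (z * (Real.log (n i) / 2 : ℝ)) * χ i x) • e i with hw
      have hww : star w * w = star x * x := by
        rw [hw, he.star_sum_smul, he.sum_smul_mul_sum_smul, hxx]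
        refine Finset.sum_congr rfl fun i _ ↦ ?_
        rw [Complex.star_def, ← Complex.normSq_eq_conj_mul_self, Complex.normSq_eq_norm_sq,
          norm_mul, hnorm, hz, zero_mul, Real.exp_zero, one_mul]
      rw [hτy, Φ.unitary, hww, hdx, Complex.ofReal_re, Real.mul_self_sqrt hN0.le]
  · rw [hf]
    refine (hq.norm_map_mul_le_of_norm_sq_eq Φ.τ_trace hyy _ fun k hk ↦ ?_).trans ?_
    · rw [hsq hz (lt_of_le_of_ne (ht0 k) hk.symm), Real.sq_sqrt (ht0 k)]
    · rw [hτy, Complex.ofReal_re, sq, mul_div_assoc]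
      gcongr
      refine (hΦ.norm_F_sum_smul_le hmin _).trans_eq ?_
      rw [← hNsum]
      congr 1
      refine Finset.sum_congr rfl fun i _ ↦ ?_
      rw [norm_mul]
      congr 1
      rcases eq_or_ne (χ i x) 0 with h | h
      · simp [hn, h]
      · rw [hsq hz (by positivity), Real.sqrt_sq (norm_nonneg _), ← sq]

end FusionBialgebra

theorem mainTheorem7 {A B : Type*}
    [CommCStarAlgebra A] [PartialOrder A] [StarOrderedRing A] [FiniteDimensional ℂ A]
    [CStarAlgebra B] [FiniteDimensional ℂ B]
    (Φ : FusionBialgebra A B) (hΦ : Φ.IsFrobeniusPerron) (x : A) :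
    (1 ≤ Φ.scale →
      vnEntropy Φ.d x + vnEntropy Φ.τ (Φ.F x) ≥
        -4 * traceNorm Φ.d x ^ 2 * Real.log (traceNorm Φ.d x)) ∧
    vnEntropy Φ.d x + vnEntropy Φ.τ (Φ.F x) ≥
      -4 * traceNorm Φ.d x ^ 2 * Real.log (traceNorm Φ.d x)
        + 2 * traceNorm Φ.d x ^ 2 * Real.log Φ.scale := by
  have h : vnEntropy Φ.d x + vnEntropy Φ.τ (Φ.F x) ≥
      -4 * traceNorm Φ.d x ^ 2 * Real.log (traceNorm Φ.d x)
        + 2 * traceNorm Φ.d x ^ 2 * Real.log Φ.scale := by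
    rcases eq_or_ne x 0 with rfl | hx
    -- For x = 0 both sides vanish, by the conventions 0 log 0 = 0 and log 0 = 0.
    · simp [vnEntropy, traceNorm, cfc_apply_zero]
    · have hN : 0 ≤ (Φ.d (star x * x)).re := (Complex.nonneg_iff.1 (Φ.d_trace.nonneg x)).1
      have := hΦ.entropy_add_entropy_ge hx
      rw [traceNorm, Real.sq_sqrt hN, Real.log_sqrt hN]
      linarith
  refine ⟨fun hκ ↦ ?_, h⟩
  have : 0 ≤ 2 * traceNorm Φ.d x ^ 2 * Real.log Φ.scale :=
    mul_nonneg (by positivity) (Real.log_nonneg hκ)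
  linarith
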